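/- All matrices are complex. For $A\in M_n$ let $\bar A$ be its entrywise conjugate; $A$ is \emph{conjugate normal} if $A^{*}A=\overline{AA^{*}}$, and $A$ is \emph{unitarily congruent} to $B\in M_n$ if $A=UBU^{T}$ for some unitary $U$. Eigenvalues are counted with algebraic multiplicity. Let $H_2(e^{i\theta})=\begin{bmatrix}0&1\\e^{i\theta}&0\end{bmatrix}$. Let $A\in M_n$ be conjugate normal. Then $A$ is unitarily congruent to a direct sum of blocks, each of which is $$[\sigma]\quad\text{or}\quad \tau H_2(e^{i\theta}),\qquad \sigma,\tau,\theta\in\mathbb R,\ \sigma\ge 0,\ \tau>0,\ 0<\theta\le\pi. \qquad (*)$$ This direct sum is uniquely determined by the eigenvalues of $\bar AA$, up to permutation of its blocks. Namely: there is one block $\sqrt\rho\,H_2(e^{i\theta})$ (with $\sqrt\rho>0$) for each conjugate pair $\{\rho e^{i\theta},\rho e^{-i\theta}\}$ of eigenvalues of $\bar AA$ with $\rho>0$ and $0<\theta\le\pi$; that is, for $0<\theta<\pi$ the number of such blocks is the multiplicity of $\rho e^{i\theta}$, which is also that of $\rho e^{-i\theta}$, and for $\theta=\pi$ it is half the multiplicity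 of $-\rho$. For each $\sigma>0$ the number of blocks $[\sigma]$ equals the multiplicity of $\sigma^2$ as an eigenvalue of $\bar AA$, so the total number of blocks $[\sigma]$ with $\sigma>0$ equals the number of positive eigenvalues of $\bar AA$. The number of blocks $[0]$ equals the nullity of $A$. If $B\in M_n$ is also conjugate normal, then $A$ is unitarily congruent to $B$ if and only if $\bar AA$ and $\bar BB$ have the same eigenvalues (with multiplicities). In a direct sum of blocks $(*)$, each (any selection) of the unitary blocks $H_2(e^{i\theta})$ can be replaced by the real orthogonal block $\begin{bmatrix}\alpha&\beta\\-\beta&\alpha\end{bmatrix}$, $\alpha=\cos(\theta/2)$, $\beta=\sin(\theta/2)$, without changing the unitary congruence class. Conversely, any $A\in M_n$ that is unitarily congruent to a direct sum of blocks $(*)$ is conjugate normal. -/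

import Mathlib

/-- The entrywise complex conjugate of a matrix. -/
def entrywiseConj {m n : Type*} (A : Matrix m n ℂ) : Matrix m n ℂ :=
  A.map (starRingEnd ℂ)

/-- `A` is conjugate normal: `A* A` is the entrywise conjugate of `A A*`. -/
def IsConjugateNormal {n : ℕ} (A : Matrix (Fin n) (Fin n) ℂ) : Prop :=
  A.conjTranspose * A = entrywiseConj (A * A.conjTranspose)

/-- `A = U B Uᵀ` for some unitary `U`. -/
def UnitarilyCongruent {n : ℕ} (A B : Matrix (Fin n) (Fin n) ℂ) : Prop :=
  ∃ U ∈ Matrix.unitaryGroup (Fin n) ℂ, A = U * B * U.transpose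

/-- The product of the entrywise conjugate of `A` with `A`. -/
def conjMulSelf {n : ℕ} (A : Matrix (Fin n) (Fin n) ℂ) : Matrix (Fin n) (Fin n) ℂ :=
  entrywiseConj A * A

/-- The eigenvalues of a matrix, listed with algebraic multiplicity. -/
noncomputable def eigenvalueMultiset {n : ℕ} (M : Matrix (Fin n) (Fin n) ℂ) : Multiset ℂ :=
  M.charpoly.roots

open scoped Classical in
/-- The multiplicity of `z` as an eigenvalue of `M` (zero if it is not an eigenvalue). -/
noncomputable def eigenvalueMultiplicity {n : ℕ} (M : Matrix (Fin n) (Fin n) ℂ) (z : ℂ) : ℕ :=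
  (eigenvalueMultiset M).count z

open scoped Classical in
/-- The number of (real) positive eigenvalues of `M`, counted with multiplicity. -/
noncomputable def numPositiveEigenvalues {n : ℕ} (M : Matrix (Fin n) (Fin n) ℂ) : ℕ :=
  (eigenvalueMultiset M).countP (fun z => ∃ x : ℝ, 0 < x ∧ z = (x : ℂ))

/-- The dimension of the null space of `A`. -/
noncomputable def matrixNullity {n : ℕ} (A : Matrix (Fin n) (Fin n) ℂ) : ℕ :=
  Module.finrank ℂ (LinearMap.ker A.mulVecLin)

/-- The unitary block with rows `(0, 1)` and `(exp (iθ), 0)`. -/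
noncomputable def blockH (θ : ℝ) : Matrix (Fin 2) (Fin 2) ℂ :=
  !![0, 1; Complex.exp (θ * Complex.I), 0]

/-- The real block with rows `(α, β)` and `(-β, α)`, `α = cos (θ/2)`, `β = sin (θ/2)`. -/
noncomputable def blockQ (θ : ℝ) : Matrix (Fin 2) (Fin 2) ℝ :=
  !![Real.cos (θ / 2), Real.sin (θ / 2); -Real.sin (θ / 2), Real.cos (θ / 2)]

/-- Parameters of a block: `one σ` stands for `[σ]`, `two τ θ` for `τ` times `blockH θ`. -/
inductive CanonicalBlock where
  | one (σ : ℝ) : CanonicalBlock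
  | two (τ θ : ℝ) : CanonicalBlock

/-- The constraints `σ ≥ 0`, respectively `τ > 0` and `0 < θ ≤ π`. -/
def CanonicalBlock.Admissible : CanonicalBlock → Prop
  | .one σ => 0 ≤ σ
  | .two τ θ => 0 < τ ∧ 0 < θ ∧ θ ≤ Real.pi

/-- The number of rows of the block. -/
def CanonicalBlock.size : CanonicalBlock → ℕ
  | .one _ => 1
  | .two _ _ => 2

/-- The block as a matrix: `[σ]` or `τ` times `blockH θ`. -/
noncomputable def CanonicalBlock.toMatrix :
    (b : CanonicalBlock) → Matrix (Fin b.size) (Fin b.size) ℂ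
  | .one σ => (!![(σ : ℂ)] : Matrix (Fin 1) (Fin 1) ℂ)
  | .two τ θ => ((τ : ℂ) • blockH θ : Matrix (Fin 2) (Fin 2) ℂ)

/-- The block with `blockH θ` replaced by the real matrix `blockQ θ`. -/
noncomputable def CanonicalBlock.toRealMatrix :
    (b : CanonicalBlock) → Matrix (Fin b.size) (Fin b.size) ℂ
  | .one σ => (!![(σ : ℂ)] : Matrix (Fin 1) (Fin 1) ℂ)
  | .two τ θ => ((τ : ℂ) • (blockQ θ).map Complex.ofReal : Matrix (Fin 2) (Fin 2) ℂ)

/-- The direct sum `M 0 ⊕ ⋯ ⊕ M (r - 1)`, the blocks placed along the diagonal in this order. -/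
def matrixDirectSum {r : ℕ} {k : Fin r → ℕ} (M : ∀ i, Matrix (Fin (k i)) (Fin (k i)) ℂ) :
    Matrix (Fin (∑ i, k i)) (Fin (∑ i, k i)) ℂ :=
  Matrix.reindex finSigmaFinEquiv finSigmaFinEquiv (Matrix.blockDiagonal' M)

/-- The sizes of the blocks `M i` add up to `n`, and `A` is unitarily congruent to their
direct sum. -/
def UnitarilyCongruentToSum {n r : ℕ} {k : Fin r → ℕ} (A : Matrix (Fin n) (Fin n) ℂ)
    (M : ∀ i, Matrix (Fin (k i)) (Fin (k i)) ℂ) : Prop :=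
  ∃ h : ∑ i, k i = n,
    UnitarilyCongruent A (Matrix.reindex (finCongr h) (finCongr h) (matrixDirectSum M))

/-- `A` is unitarily congruent to the direct sum of the blocks `b i`, all of them admissible. -/
def HasBlockForm {n r : ℕ} (A : Matrix (Fin n) (Fin n) ℂ) (b : Fin r → CanonicalBlock) : Prop :=
  (∀ i, (b i).Admissible) ∧ UnitarilyCongruentToSum A (fun i => (b i).toMatrix)

/-! Attach to $A$ the antilinear maps $Sx=\overline{Ax}$ and $Tx=\overline{A^{T}x}$ on $\mathbb
C^n$. They satisfy $\langle x,Sy\rangle=\langle y,Tx\rangle$, and conjugate normality of $A$ gives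
$TS=ST$. Moreover $S^2=\bar AA$ and $TS=A^*A$ are linear and commute, so they have a common
eigenvector $x$ in every nonzero subspace invariant under $S$ and $T$. If the eigenvalue of $S^2$ is
real and nonnegative, a vector fixed by $S$ up to a scalar $\sigma\ge 0$ gives a block $[\sigma]$
(`exists_block_one`). Otherwise $x$ and $Sx$ are orthogonal and span a two-dimensional block
(`exists_block_two`). Orthogonal complements of blocks are again invariant, so a maximal orthonormal
family of blocks spans everything (`exists_block_basis`).

For uniqueness, unitary congruence of $A$ is a similarity of $\bar AA$, and $\bar DD$ is diagonal
for a sum $D$ of blocks. The spectrum of $\bar AA$ is therefore read off the blocks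
(`eigenvalueMultiset_of_hasBlockForm`), and each admissible block is counted by the multiplicity of
one suitable eigenvalue (`exists_detecting_eigenvalue`). Equal spectra thus give the same blocks up
to order, and reordering blocks is a unitary congruence. -/

open Matrix
open scoped InnerProductSpace

/-! ### Commuting antilinear maps and their orthogonal splitting into blocks -/

section Antilinear

variable {V : Type*} [NormedAddCommGroup V] [InnerProductSpace ℂ V]

/-- `v` is an orthonormal family spanning a subspace invariant under the antilinear maps `S` and
`T`, on which they act through the block `b`. -/
def IsBlockFamily (S T : V →ₛₗ[starRingEnd ℂ] V) (b : CanonicalBlock) (v : Fin b.size → V) :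
    Prop :=
  Orthonormal ℂ v ∧ (∀ q, S (v q) = ∑ p, starRingEnd ℂ (b.toMatrix p q) • v p) ∧
    ∀ q, T (v q) = ∑ p, starRingEnd ℂ (b.toMatrix q p) • v p

/-- The antilinear analogue of $\|N^*x\|=\|Nx\|$ for normal $N$: both squares equal $\langle
x,STx\rangle=\langle x,TSx\rangle$. -/
theorem norm_antilinear_eq {S T : V →ₛₗ[starRingEnd ℂ] V}
    (hT : ∀ x y, ⟪x, S y⟫_ℂ = ⟪y, T x⟫_ℂ) (hN : ∀ x, T (S x) = S (T x)) (x : V) :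
    ‖T x‖ = ‖S x‖ := by
  have h : ⟪T x, T x⟫_ℂ = ⟪S x, S x⟫_ℂ := by
    rw [← hT x (T x), hT (S x) x, hN]
  rw [inner_self_eq_norm_sq_to_K, inner_self_eq_norm_sq_to_K] at h
  have h2 : ‖T x‖ ^ 2 = ‖S x‖ ^ 2 := by exact_mod_cast h
  exact (sq_eq_sq₀ (norm_nonneg _) (norm_nonneg _)).1 h2

/-- Expanding the squares gives $\|Ty-\sigma y\|=\|Sy-\sigma y\|$: the norms of $Ty$ and $Sy$ agree,
and so do the cross terms, since $\langle y,Sy\rangle=\langle y,Ty\rangle$. -/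
theorem antilinear_adjoint_eigenvector {S T : V →ₛₗ[starRingEnd ℂ] V}
    (hT : ∀ x y, ⟪x, S y⟫_ℂ = ⟪y, T x⟫_ℂ) (hN : ∀ x, T (S x) = S (T x)) {y : V} {σ : ℝ}
    (hy : S y = (σ : ℂ) • y) : T y = (σ : ℂ) • y := by
  have h1 : ‖T y - (σ : ℂ) • y‖ ^ 2 = ‖S y - (σ : ℂ) • y‖ ^ 2 := by
    rw [norm_sub_sq (𝕜 := ℂ), norm_sub_sq (𝕜 := ℂ), norm_antilinear_eq hT hN y, inner_smul_right,
      inner_smul_right, ← inner_conj_symm (T y), ← inner_conj_symm (S y), hT]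
  rw [hy, sub_self, norm_zero] at h1
  have h2 : ‖T y - (σ : ℂ) • y‖ = 0 := by simpa using h1
  exact sub_eq_zero.1 (norm_eq_zero.1 h2)

theorem exists_eigenvector_mem [FiniteDimensional ℂ V] (f : V →ₗ[ℂ] V) (W : Submodule ℂ V)
    (hW : W ≠ ⊥) (hf : ∀ x ∈ W, f x ∈ W) : ∃ x ∈ W, x ≠ 0 ∧ ∃ μ : ℂ, f x = μ • x := by
  have : Nontrivial W := Submodule.nontrivial_iff_ne_bot.2 hW
  obtain ⟨μ, hμ⟩ := Module.End.exists_eigenvalue (f.restrict hf)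
  obtain ⟨x, hx⟩ := hμ.exists_hasEigenvector
  refine ⟨x, x.2, fun h => hx.2 (Subtype.ext h), μ, ?_⟩
  have := congrArg Subtype.val hx.apply_eq_smul
  simpa using this

theorem exists_block_one {S T : V →ₛₗ[starRingEnd ℂ] V}
    (hT : ∀ x y, ⟪x, S y⟫_ℂ = ⟪y, T x⟫_ℂ) (hN : ∀ x, T (S x) = S (T x)) {W : Submodule ℂ V}
    (hS : ∀ x ∈ W, S x ∈ W) {x : V} (hx : x ∈ W) (hx0 : x ≠ 0) {σ : ℝ} (hσ : 0 ≤ σ)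
    (hl : S (S x) = ((σ : ℂ) ^ 2) • x) :
    ∃ b : CanonicalBlock, b.Admissible ∧ ∃ v : Fin b.size → V,
      IsBlockFamily S T b v ∧ ∀ p, v p ∈ W := by
  obtain ⟨y, hyW, hy0, hy⟩ : ∃ y ∈ W, y ≠ 0 ∧ S y = (σ : ℂ) • y := by
    by_cases h : S x + (σ : ℂ) • x = 0
    -- Here $Sx=-\sigma x$, and antilinearity reverses the sign on $ix$.
    · refine ⟨Complex.I • x, W.smul_mem _ hx, by simp [hx0], ?_⟩
      rw [LinearMap.map_smulₛₗ, eq_neg_of_add_eq_zero_left h, Complex.conj_I, smul_neg, neg_smul,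
        neg_neg, smul_comm]
    -- $S(Sx+\sigma x)=\sigma^2x+\sigma Sx=\sigma(Sx+\sigma x)$.
    · refine ⟨_, W.add_mem (hS x hx) (W.smul_mem _ hx), h, ?_⟩
      rw [map_add, LinearMap.map_smulₛₗ, hl, Complex.conj_ofReal, smul_add, smul_smul, add_comm,
        pow_two]
  obtain ⟨u, huW, hu1, hu⟩ : ∃ u ∈ W, ‖u‖ = 1 ∧ S u = (σ : ℂ) • u := by
    refine ⟨((‖y‖⁻¹ : ℝ) : ℂ) • y, W.smul_mem _ hyW, ?_, ?_⟩
    · rw [norm_smul, Complex.norm_real, norm_inv, norm_norm, inv_mul_cancel₀ (norm_ne_zero_iff.2 hy0)]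
    · rw [LinearMap.map_smulₛₗ, hy, Complex.conj_ofReal, smul_comm]
  have hu' := antilinear_adjoint_eigenvector hT hN hu
  refine ⟨.one σ, hσ, fun _ => u, ⟨⟨fun _ => hu1, fun i j hij => ?_⟩, fun q => ?_, fun q => ?_⟩,
    fun _ => huW⟩
  · exact absurd (Subsingleton.elim (α := Fin 1) i j) hij
  · change S u = ∑ p : Fin 1, starRingEnd ℂ ((!![(σ : ℂ)] : Matrix (Fin 1) (Fin 1) ℂ) p q) • u
    obtain rfl : q = (0 : Fin 1) := Subsingleton.elim (α := Fin 1) _ _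
    simp [hu]
  · change T u = ∑ p : Fin 1, starRingEnd ℂ ((!![(σ : ℂ)] : Matrix (Fin 1) (Fin 1) ℂ) q p) • u
    obtain rfl : q = (0 : Fin 1) := Subsingleton.elim (α := Fin 1) _ _
    simp [hu']

/-- The block basis is $(y,x)$ with $y=\tau^{-1}Sx$: `hl` closes the span under $S$, and `hm` makes
$y$ a unit vector. -/
theorem exists_block_two {S T : V →ₛₗ[starRingEnd ℂ] V}
    (hT : ∀ x y, ⟪x, S y⟫_ℂ = ⟪y, T x⟫_ℂ) (hN : ∀ x, T (S x) = S (T x)) {W : Submodule ℂ V}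
    (hS : ∀ x ∈ W, S x ∈ W) {x : V} (hx : x ∈ W) (hx1 : ‖x‖ = 1) {τ θ : ℝ} (hτ : 0 < τ)
    (hθ : 0 < θ) (hθ' : θ ≤ Real.pi)
    (hl : S (S x) = ((τ : ℂ) ^ 2 * starRingEnd ℂ (Complex.exp (θ * Complex.I))) • x)
    (hm : T (S x) = ((τ : ℂ) ^ 2) • x) :
    ∃ b : CanonicalBlock, b.Admissible ∧ ∃ v : Fin b.size → V,
      IsBlockFamily S T b v ∧ ∀ p, v p ∈ W := by
  set w := Complex.exp (θ * Complex.I) with hw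
  have hww : w * starRingEnd ℂ w = 1 := by
    rw [Complex.mul_conj, Complex.normSq_eq_norm_sq, hw, Complex.norm_exp_ofReal_mul_I]; simp
  have hτ0 : (τ : ℂ) ≠ 0 := by exact_mod_cast hτ.ne'
  have hw1 : starRingEnd ℂ w ≠ 1 := by
    intro h
    have h2 : w = 1 := by
      have := congrArg (starRingEnd ℂ) h
      simpa using this
    have h3 : Real.cos θ = 1 := by
      have := congrArg Complex.re h2
      simpa [hw, Complex.exp_ofReal_mul_I_re] using this
    have h4 : Real.cos θ < Real.cos 0 :=
      Real.cos_lt_cos_of_nonneg_of_le_pi le_rfl hθ' hθ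
    rw [Real.cos_zero] at h4
    exact h4.ne h3
  obtain ⟨y, hy⟩ : ∃ y, y = (τ : ℂ)⁻¹ • S x := ⟨_, rfl⟩
  have hSx : S x = (τ : ℂ) • y := by rw [hy, smul_smul, mul_inv_cancel₀ hτ0, one_smul]
  have hSy : S y = ((τ : ℂ) * starRingEnd ℂ w) • x := by
    rw [hy, LinearMap.map_smulₛₗ, hl, map_inv₀, Complex.conj_ofReal, smul_smul]
    congr 1; field_simp
  have hTy : T y = (τ : ℂ) • x := by
    rw [hy, LinearMap.map_smulₛₗ, hm, map_inv₀, Complex.conj_ofReal, smul_smul]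
    congr 1; field_simp
  -- Evaluating $TS=ST$ at $y$ gives $\tau w\,Tx=\tau^2y$.
  have hTx : T x = ((τ : ℂ) * starRingEnd ℂ w) • y := by
    have h1 : T (S y) = S (T y) := hN y
    rw [hSy, hTy, LinearMap.map_smulₛₗ, LinearMap.map_smulₛₗ, map_mul, Complex.conj_ofReal,
      Complex.conj_conj, hSx] at h1
    have h2 := congrArg (fun z => ((τ : ℂ)⁻¹ * starRingEnd ℂ w) • z) h1
    simp only [smul_smul] at h2
    have e1 : (τ : ℂ)⁻¹ * starRingEnd ℂ w * (τ * w) = 1 := by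
      rw [← hww]; field_simp
    have e2 : (τ : ℂ)⁻¹ * starRingEnd ℂ w * (τ * τ) = τ * starRingEnd ℂ w := by field_simp
    rwa [e1, one_smul, e2] at h2
  have hxx : ⟪x, x⟫_ℂ = 1 := by rw [inner_self_eq_norm_sq_to_K, hx1]; simp
  have hyy : ⟪y, y⟫_ℂ = 1 := by
    have h := hT (S x) x
    rw [hm, hSx, inner_smul_left, inner_smul_right, inner_smul_right, hxx, Complex.conj_ofReal] at h
    have : (τ : ℂ) ^ 2 * (⟪y, y⟫_ℂ - 1) = 0 := by linear_combination h
    rcases mul_eq_zero.1 this with h' | h'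
    · exact absurd h' (pow_ne_zero _ hτ0)
    · exact sub_eq_zero.1 h'
  have hy1 : ‖y‖ = 1 := by
    rw [@norm_eq_sqrt_re_inner ℂ, hyy]; simp
  -- From $\langle x,Sx\rangle=\langle x,Tx\rangle$ one gets $\tau(1-\bar w)\langle x,y\rangle=0$;
  -- this is where $w\ne1$, that is $0<\theta\le\pi$, is needed.
  have hxy : ⟪x, y⟫_ℂ = 0 := by
    have h := hT x x
    rw [hSx, hTx, inner_smul_right, inner_smul_right] at h
    have : (τ : ℂ) * (1 - starRingEnd ℂ w) * ⟪x, y⟫_ℂ = 0 := by linear_combination h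
    rcases mul_eq_zero.1 this with h' | h'
    · rcases mul_eq_zero.1 h' with h'' | h''
      · exact absurd h'' hτ0
      · exact absurd (sub_eq_zero.1 h'').symm hw1
    · exact h'
  have hyx : ⟪y, x⟫_ℂ = 0 := inner_eq_zero_symm.1 hxy
  have hyW : y ∈ W := hy ▸ W.smul_mem _ (hS x hx)
  refine ⟨.two τ θ, ⟨hτ, hθ, hθ'⟩, (![y, x] : Fin 2 → V), ⟨?_, fun q => ?_, fun q => ?_⟩, ?_⟩
  · change Orthonormal ℂ (![y, x] : Fin 2 → V)
    rw [orthonormal_iff_ite]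
    intro i j
    fin_cases i <;> fin_cases j <;> simp [hx1, hy1, hxy, hyx]
  · change S ((![y, x] : Fin 2 → V) q) = ∑ p : Fin 2, starRingEnd ℂ
      (((τ : ℂ) • blockH θ : Matrix (Fin 2) (Fin 2) ℂ) p q) • (![y, x] : Fin 2 → V) p
    change Fin 2 at q
    fin_cases q
    · simp [blockH, Fin.sum_univ_two, hSy, ← hw]
    · simp [blockH, Fin.sum_univ_two, hSx]
  · change T ((![y, x] : Fin 2 → V) q) = ∑ p : Fin 2, starRingEnd ℂ
      (((τ : ℂ) • blockH θ : Matrix (Fin 2) (Fin 2) ℂ) q p) • (![y, x] : Fin 2 → V) p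
    change Fin 2 at q
    fin_cases q
    · simp [blockH, Fin.sum_univ_two, hTy]
    · simp [blockH, Fin.sum_univ_two, hTx, ← hw]
  · intro p
    change Fin 2 at p
    fin_cases p
    · exact hyW
    · exact hx

/-- Takes $\tau=\sqrt\rho$ and $\theta=\arg\bar l$. The conjugate appears because $S^2$ acts on the
second basis vector of a block by $\tau^2e^{-i\theta}$, so $\operatorname{Im} l\le0$ is what puts
$\theta$ in $(0,\pi]$. -/
theorem exists_block_of_eigenvector {S T : V →ₛₗ[starRingEnd ℂ] V}
    (hT : ∀ x y, ⟪x, S y⟫_ℂ = ⟪y, T x⟫_ℂ) (hN : ∀ x, T (S x) = S (T x)) {W : Submodule ℂ V}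
    (hS : ∀ x ∈ W, S x ∈ W) {x : V} (hx : x ∈ W) (hx0 : x ≠ 0) {l : ℂ} {ρ : ℝ} (hρ : 0 < ρ)
    (hlρ : ‖l‖ = ρ) (hne : l ≠ ρ) (him : l.im ≤ 0) (hl : S (S x) = l • x)
    (hm : T (S x) = (ρ : ℂ) • x) :
    ∃ b : CanonicalBlock, b.Admissible ∧ ∃ v : Fin b.size → V,
      IsBlockFamily S T b v ∧ ∀ p, v p ∈ W := by
  have hsq : ((Real.sqrt ρ : ℝ) : ℂ) ^ 2 = ρ := by
    exact_mod_cast Real.sq_sqrt hρ.le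
  have hexp : (ρ : ℂ) * Complex.exp ((Complex.arg (starRingEnd ℂ l) : ℝ) * Complex.I)
      = starRingEnd ℂ l := by
    rw [← hlρ, ← Complex.norm_conj l]; exact Complex.norm_mul_exp_arg_mul_I _
  have hθ0 : 0 ≤ Complex.arg (starRingEnd ℂ l) := by
    rw [Complex.arg_nonneg_iff]; simpa using him
  have hθne : Complex.arg (starRingEnd ℂ l) ≠ 0 := by
    intro h
    rw [h] at hexp
    apply hne
    have := congrArg (starRingEnd ℂ) hexp
    simpa using this.symm
  have hn : ‖((‖x‖⁻¹ : ℝ) : ℂ) • x‖ = 1 := by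
    rw [norm_smul, Complex.norm_real, norm_inv, norm_norm, inv_mul_cancel₀ (norm_ne_zero_iff.2 hx0)]
  refine exists_block_two hT hN hS (W.smul_mem ((‖x‖⁻¹ : ℝ) : ℂ) hx) hn (Real.sqrt_pos.2 hρ)
    (lt_of_le_of_ne hθ0 (Ne.symm hθne)) (Complex.arg_le_pi _) ?_ ?_
  · have e : (ρ : ℂ) * starRingEnd ℂ
        (Complex.exp ((Complex.arg (starRingEnd ℂ l) : ℝ) * Complex.I)) = l := by
      have := congrArg (starRingEnd ℂ) hexp
      rwa [map_mul, Complex.conj_ofReal, Complex.conj_conj] at this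
    rw [hsq, e, LinearMap.map_smulₛₗ, LinearMap.map_smulₛₗ, hl, Complex.conj_conj, smul_comm]
  · rw [hsq, LinearMap.map_smulₛₗ, LinearMap.map_smulₛₗ, hm, Complex.conj_conj, smul_comm]

theorem exists_block_mem [FiniteDimensional ℂ V] {S T : V →ₛₗ[starRingEnd ℂ] V}
    (hT : ∀ x y, ⟪x, S y⟫_ℂ = ⟪y, T x⟫_ℂ) (hN : ∀ x, T (S x) = S (T x)) {W : Submodule ℂ V}
    (hW : W ≠ ⊥) (hS : ∀ x ∈ W, S x ∈ W) (hTW : ∀ x ∈ W, T x ∈ W) :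
    ∃ b : CanonicalBlock, b.Admissible ∧ ∃ v : Fin b.size → V,
      IsBlockFamily S T b v ∧ ∀ p, v p ∈ W := by
  obtain ⟨x₀, hx₀W, hx₀, l, hl₀⟩ := exists_eigenvector_mem (S.comp S) W hW
    (fun x hx => hS _ (hS x hx))
  let W' : Submodule ℂ V := W ⊓ LinearMap.ker (S.comp S - l • (LinearMap.id : V →ₗ[ℂ] V))
  have hmem : ∀ z, z ∈ W' ↔ z ∈ W ∧ S (S z) = l • z := by
    intro z
    simp [W', LinearMap.mem_ker, sub_eq_zero]
  have hW' : W' ≠ ⊥ := by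
    intro h
    have : x₀ ∈ W' := (hmem _).2 ⟨hx₀W, by simpa using hl₀⟩
    rw [h] at this
    exact hx₀ (by simpa using this)
  -- The eigenspace $W'$ of $S^2$ is invariant under $TS$, which commutes with $S^2$; this yields a
  -- common eigenvector.
  obtain ⟨x, hx', hx0, m, hm⟩ := exists_eigenvector_mem (T.comp S) W' hW' (by
    intro z hz
    obtain ⟨h1, h2⟩ := (hmem z).1 hz
    refine (hmem _).2 ⟨hTW _ (hS _ h1), ?_⟩
    change S (S (T (S z))) = l • T (S z)
    rw [← hN, ← hN, h2, LinearMap.map_smulₛₗ, LinearMap.map_smulₛₗ, Complex.conj_conj])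
  obtain ⟨hx, hl⟩ := (hmem x).1 hx'
  replace hm : T (S x) = m • x := by simpa using hm
  by_cases hpos : l = ‖l‖
  · have h2 : S (S x) = (((Real.sqrt ‖l‖ : ℝ) : ℂ) ^ 2) • x := by
      have : ((Real.sqrt ‖l‖ : ℝ) : ℂ) ^ 2 = ‖l‖ := by
        exact_mod_cast Real.sq_sqrt (norm_nonneg l)
      rw [this, ← hpos, hl]
    exact exists_block_one hT hN hS hx hx0 (Real.sqrt_nonneg _) h2
  · have hl0 : l ≠ 0 := by rintro rfl; simp at hpos
    have hSx0 : S x ≠ 0 := by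
      intro h
      rw [h, map_zero] at hl
      exact (smul_ne_zero hl0 hx0) hl.symm
    have hin : ((‖S x‖ : ℂ)) ^ 2 = m * (‖x‖ : ℂ) ^ 2 := by
      have h := hT (S x) x
      rw [hm, inner_smul_right, inner_self_eq_norm_sq_to_K, inner_self_eq_norm_sq_to_K] at h
      simpa using h
    have hxn : (‖x‖ : ℂ) ≠ 0 := by exact_mod_cast norm_ne_zero_iff.2 hx0
    obtain ⟨μ, hμ0, rfl⟩ : ∃ μ : ℝ, 0 ≤ μ ∧ m = μ := by
      refine ⟨‖S x‖ ^ 2 / ‖x‖ ^ 2, by positivity, ?_⟩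
      push_cast
      rw [hin]; field_simp
    have hTx : starRingEnd ℂ l • T x = (μ : ℂ) • S x := by
      have h := hN (S x)
      rw [hl, hm, LinearMap.map_smulₛₗ, LinearMap.map_smulₛₗ, Complex.conj_ofReal] at h
      exact h
    -- Taking norms in $\bar l\,Tx=\mu\,Sx$ and using $\|Tx\|=\|Sx\|\ne0$.
    have hμ : ‖l‖ = μ := by
      have h := congrArg norm hTx
      rw [norm_smul, norm_smul, norm_antilinear_eq hT hN, Complex.norm_conj, Complex.norm_real,
        Real.norm_of_nonneg hμ0] at h
      exact mul_right_cancel₀ (norm_ne_zero_iff.2 hSx0) h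
    have hμpos : 0 < μ := by rw [← hμ]; exact norm_pos_iff.2 hl0
    rw [hμ] at hpos
    rcases le_total l.im 0 with him | him
    · exact exists_block_of_eigenvector hT hN hS hx hx0 hμpos hμ hpos him hl hm
    -- When $l$ lies in the upper half plane, $Sx$ replaces $x$: its eigenvalue under $S^2$ is $\bar
    -- l$.
    · refine exists_block_of_eigenvector hT hN hS (hS x hx) hSx0 (l := starRingEnd ℂ l) hμpos
        (by rw [Complex.norm_conj, hμ]) ?_ (by simpa using him) ?_ ?_
      · intro h
        have := congrArg (starRingEnd ℂ) h
        exact hpos (by simpa using this)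
      · rw [hl, LinearMap.map_smulₛₗ]
      · rw [hN, hm, LinearMap.map_smulₛₗ, Complex.conj_ofReal]

theorem exists_block_basis [FiniteDimensional ℂ V] {S T : V →ₛₗ[starRingEnd ℂ] V}
    (hT : ∀ x y, ⟪x, S y⟫_ℂ = ⟪y, T x⟫_ℂ) (hN : ∀ x, T (S x) = S (T x)) :
    ∃ (r : ℕ) (b : Fin r → CanonicalBlock) (v : ∀ i, Fin (b i).size → V),
      (∀ i, (b i).Admissible) ∧ (∀ i, IsBlockFamily S T (b i) (v i)) ∧
      Orthonormal ℂ (fun x : Σ i, Fin (b i).size => v x.1 x.2) ∧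
      Submodule.span ℂ (Set.range fun x : Σ i, Fin (b i).size => v x.1 x.2) = ⊤ := by
  classical
  let P : ℕ → Prop := fun r => ∃ (b : Fin r → CanonicalBlock) (v : ∀ i, Fin (b i).size → V),
      (∀ i, (b i).Admissible) ∧ (∀ i, IsBlockFamily S T (b i) (v i)) ∧
      Orthonormal ℂ (fun x : Σ i, Fin (b i).size => v x.1 x.2)
  have hsize : ∀ b : CanonicalBlock, 0 < b.size := by
    rintro (σ | ⟨τ, θ⟩) <;> simp [CanonicalBlock.size]
  have hbound : ∀ r, P r → r ≤ Module.finrank ℂ V := by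
    rintro r ⟨b, v, -, -, ho⟩
    have h1 := ho.linearIndependent.fintype_card_le_finrank
    refine le_trans ?_ h1
    rw [Fintype.card_sigma]
    calc r = ∑ i : Fin r, 1 := by simp
      _ ≤ _ := Finset.sum_le_sum fun i _ => by rw [Fintype.card_fin]; exact hsize (b i)
  have h0 : P 0 := ⟨fun i => i.elim0, fun i => i.elim0, fun i => i.elim0, fun i => i.elim0,
    ⟨fun i => i.1.elim0, fun i => i.1.elim0⟩⟩
  -- A maximal number of orthonormal blocks; blocks are nonempty, so the dimension bounds it.
  let r := Nat.findGreatest P (Module.finrank ℂ V)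
  have hr : P r := Nat.findGreatest_spec (Nat.zero_le _) h0
  have hr1 : ¬ P (r + 1) := fun h => by
    have := Nat.le_findGreatest (hbound _ h) h
    exact absurd this (Nat.not_succ_le_self _)
  obtain ⟨b, v, hadm, hb, ho⟩ := hr
  refine ⟨r, b, v, hadm, hb, ho, ?_⟩
  by_contra hspan
  apply hr1
  set U := Submodule.span ℂ (Set.range fun x : Σ i, Fin (b i).size => v x.1 x.2) with hU
  have hW : Uᗮ ≠ ⊥ := fun h => hspan (Submodule.orthogonal_eq_bot_iff.1 h)
  have hmemU : ∀ i p, v i p ∈ U := fun i p => Submodule.subset_span ⟨⟨i, p⟩, rfl⟩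
  have hmem : ∀ z, z ∈ Uᗮ ↔ ∀ i p, ⟪v i p, z⟫_ℂ = 0 := by
    intro z
    constructor
    · intro hz i p
      exact (Submodule.mem_orthogonal _ _).1 hz _ (hmemU i p)
    · intro h
      rw [Submodule.mem_orthogonal']
      intro u hu
      induction hu using Submodule.span_induction with
      | mem x hx => obtain ⟨⟨i, p⟩, rfl⟩ := hx; exact inner_eq_zero_symm.1 (h i p)
      | zero => simp
      | add x y _ _ hx hy => rw [inner_add_right, hx, hy, add_zero]
      | smul a x _ hx => rw [inner_smul_right, hx, mul_zero]
  have horth : ∀ z ∈ Uᗮ, ∀ u ∈ U, ⟪z, u⟫_ℂ = 0 := fun z hz u hu =>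
    (Submodule.mem_orthogonal' _ _).1 hz u hu
  -- $U^\perp$ is $S$-invariant because $U$ is $T$-invariant, and conversely; a block found there
  -- contradicts maximality.
  obtain ⟨b₀, hadm₀, v₀, hb₀, hv₀⟩ := exists_block_mem hT hN hW
    (fun z hz => (hmem _).2 fun i p => by
      rw [hT]
      refine horth z hz _ ?_
      rw [(hb i).2.2 p]
      exact U.sum_mem fun q _ => U.smul_mem _ (hmemU i q))
    (fun z hz => (hmem _).2 fun i p => by
      rw [← hT]
      refine horth z hz _ ?_
      rw [(hb i).2.1 p]
      exact U.sum_mem fun q _ => U.smul_mem _ (hmemU i q))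
  refine ⟨Fin.cons b₀ b, Fin.cases v₀ v, Fin.cases hadm₀ hadm, Fin.cases hb₀ hb, ?_⟩
  have hov := orthonormal_iff_ite.1 ho
  constructor
  · rintro ⟨i, p⟩
    induction i using Fin.cases with
    | zero => exact hb₀.1.1 p
    | succ i => exact ho.1 ⟨i, p⟩
  · rintro ⟨i, p⟩ ⟨j, q⟩ hne
    induction i using Fin.cases with
    | zero =>
      induction j using Fin.cases with
      | zero =>
        refine hb₀.1.2 (i := p) (j := q) ?_
        rintro rfl; exact hne rfl
      | succ j => exact horth _ (hv₀ p) _ (hmemU j q)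
    | succ i =>
      induction j using Fin.cases with
      | zero => exact (hmem _).1 (hv₀ q) i p
      | succ j =>
        refine ho.2 (i := ⟨i, p⟩) (j := ⟨j, q⟩) ?_
        intro h
        apply hne
        obtain ⟨rfl, h2⟩ := Sigma.mk.inj_iff.1 h
        rw [eq_of_heq h2]

end Antilinear

/-! ### Computations with a single block -/

/-- The diagonal entries of the product of the conjugate of a block with the block. -/
noncomputable def CanonicalBlock.eigen : (b : CanonicalBlock) → Fin b.size → ℂ
  | .one σ => (fun _ => (σ : ℂ) ^ 2 : Fin 1 → ℂ)
  | .two τ θ => (![(τ : ℂ) ^ 2 * Complex.exp (θ * Complex.I),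
      (τ : ℂ) ^ 2 * Complex.exp (-(θ * Complex.I))] : Fin 2 → ℂ)

/-- The square of the singular value of a block. -/
def CanonicalBlock.sqNorm : CanonicalBlock → ℝ
  | .one σ => σ ^ 2
  | .two τ _ => τ ^ 2

theorem conj_exp_mul_I (θ : ℝ) :
    starRingEnd ℂ (Complex.exp (θ * Complex.I)) = Complex.exp (-(θ * Complex.I)) := by
  rw [← Complex.exp_conj]; simp

theorem CanonicalBlock.conj_mul_toMatrix (b : CanonicalBlock) :
    entrywiseConj b.toMatrix * b.toMatrix = diagonal b.eigen := by
  rcases b with σ | ⟨τ, θ⟩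
  · change entrywiseConj (!![(σ : ℂ)] : Matrix (Fin 1) (Fin 1) ℂ) * !![(σ : ℂ)] =
      diagonal (fun _ => (σ : ℂ) ^ 2 : Fin 1 → ℂ)
    ext i j
    fin_cases i; fin_cases j
    simp [entrywiseConj, Matrix.mul_apply, sq]
  · change entrywiseConj ((τ : ℂ) • blockH θ : Matrix (Fin 2) (Fin 2) ℂ) * ((τ : ℂ) • blockH θ) =
      diagonal (![(τ : ℂ) ^ 2 * Complex.exp (θ * Complex.I),
        (τ : ℂ) ^ 2 * Complex.exp (-(θ * Complex.I))] : Fin 2 → ℂ)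
    ext i j
    fin_cases i <;> fin_cases j <;>
      simp [entrywiseConj, Matrix.mul_apply, blockH, Fin.sum_univ_two, conj_exp_mul_I] <;> ring

theorem CanonicalBlock.conjTranspose_mul_toMatrix (b : CanonicalBlock) :
    b.toMatrixᴴ * b.toMatrix = diagonal fun _ => (b.sqNorm : ℂ) := by
  rcases b with σ | ⟨τ, θ⟩
  · change (!![(σ : ℂ)] : Matrix (Fin 1) (Fin 1) ℂ)ᴴ * !![(σ : ℂ)] =
      diagonal (fun _ => ((σ ^ 2 : ℝ) : ℂ) : Fin 1 → ℂ)
    ext i j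
    fin_cases i; fin_cases j
    simp [Matrix.mul_apply, sq]
  · change ((τ : ℂ) • blockH θ : Matrix (Fin 2) (Fin 2) ℂ)ᴴ * ((τ : ℂ) • blockH θ) =
      diagonal (fun _ => ((τ ^ 2 : ℝ) : ℂ) : Fin 2 → ℂ)
    ext i j
    fin_cases i <;> fin_cases j <;>
      simp [Matrix.mul_apply, blockH, Fin.sum_univ_two, conj_exp_mul_I, sq]
    rw [mul_mul_mul_comm, ← Complex.exp_add]; simp

theorem CanonicalBlock.mul_conjTranspose_toMatrix (b : CanonicalBlock) :
    b.toMatrix * b.toMatrixᴴ = diagonal fun _ => (b.sqNorm : ℂ) := by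
  rcases b with σ | ⟨τ, θ⟩
  · change (!![(σ : ℂ)] : Matrix (Fin 1) (Fin 1) ℂ) * (!![(σ : ℂ)])ᴴ =
      diagonal (fun _ => ((σ ^ 2 : ℝ) : ℂ) : Fin 1 → ℂ)
    ext i j
    fin_cases i; fin_cases j
    simp [Matrix.mul_apply, sq]
  · change ((τ : ℂ) • blockH θ : Matrix (Fin 2) (Fin 2) ℂ) * ((τ : ℂ) • blockH θ)ᴴ =
      diagonal (fun _ => ((τ ^ 2 : ℝ) : ℂ) : Fin 2 → ℂ)
    ext i j
    fin_cases i <;> fin_cases j <;>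
      simp [Matrix.mul_apply, blockH, Fin.sum_univ_two, conj_exp_mul_I, sq]
    rw [mul_mul_mul_comm, ← Complex.exp_add]; simp

/-- A unitary matrix carrying `blockQ θ` to `blockH θ` by congruence. -/
noncomputable def realToUnitary (θ : ℝ) : Matrix (Fin 2) (Fin 2) ℂ :=
  (Complex.exp ((θ / 4 : ℝ) * Complex.I) * (((Real.sqrt 2)⁻¹ : ℝ) : ℂ)) •
    !![1, Complex.I; 1, -Complex.I]

theorem realToUnitary_mem (θ : ℝ) : realToUnitary θ * (realToUnitary θ)ᴴ = 1 := by
  have h1 : Complex.exp ((θ / 4 : ℝ) * Complex.I) *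
      starRingEnd ℂ (Complex.exp ((θ / 4 : ℝ) * Complex.I)) = 1 := by
    rw [conj_exp_mul_I, ← Complex.exp_add, add_neg_cancel, Complex.exp_zero]
  have h2 : (((Real.sqrt 2)⁻¹ : ℝ) : ℂ) * (((Real.sqrt 2)⁻¹ : ℝ) : ℂ) = 1 / 2 := by
    rw [← Complex.ofReal_mul, ← mul_inv, Real.mul_self_sqrt (by norm_num)]; norm_num
  rw [realToUnitary, conjTranspose_smul, smul_mul, Matrix.mul_smul, smul_smul]
  have h3 : ∀ a c : ℂ, a * starRingEnd ℂ a = 1 → starRingEnd ℂ c = c → c * c = 1 / 2 →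
      a * c * star (a * c) = 1 / 2 := by
    intro a c ha hc hcc
    rw [star_mul', ← starRingEnd_apply, ← starRingEnd_apply, hc, mul_mul_mul_comm, ha, hcc, one_mul]
  rw [h3 _ _ h1 (Complex.conj_ofReal _) h2]
  have e : (!![1, Complex.I; 1, -Complex.I] : Matrix (Fin 2) (Fin 2) ℂ)ᴴ =
      !![1, 1; -Complex.I, Complex.I] := by
    ext i j
    fin_cases i <;> fin_cases j <;> simp
  rw [e, mul_fin_two]
  ext i j
  fin_cases i <;> fin_cases j <;> simp <;> norm_num

/-- The rows $(1,\pm i)$ are isotropic for the bilinear form $xy^T$, so the diagonal vanishes. The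
off-diagonal entries become $e^{\mp i\theta/2}$, and the phase $e^{i\theta/4}$, which enters twice,
turns them into $1$ and $e^{i\theta}$. -/
theorem blockH_eq (θ : ℝ) : blockH θ =
    realToUnitary θ * (blockQ θ).map Complex.ofReal * (realToUnitary θ)ᵀ := by
  have h2 : (((Real.sqrt 2)⁻¹ : ℝ) : ℂ) * (((Real.sqrt 2)⁻¹ : ℝ) : ℂ) = 1 / 2 := by
    rw [← Complex.ofReal_mul, ← mul_inv, Real.mul_self_sqrt (by norm_num)]; norm_num
  have h4 : Complex.exp ((θ / 4 : ℝ) * Complex.I) * Complex.exp ((θ / 4 : ℝ) * Complex.I) =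
      Complex.exp ((θ / 2 : ℝ) * Complex.I) := by
    rw [← Complex.exp_add]; congr 1; push_cast; ring
  have h5 : Complex.exp ((θ / 2 : ℝ) * Complex.I) * Complex.exp ((θ / 2 : ℝ) * Complex.I) =
      Complex.exp (θ * Complex.I) := by
    rw [← Complex.exp_add]; congr 1; push_cast; ring
  have h6 : Complex.exp ((θ / 2 : ℝ) * Complex.I) =
      (Real.cos (θ / 2) : ℂ) + (Real.sin (θ / 2) : ℂ) * Complex.I := by
    rw [Complex.exp_mul_I, ← Complex.ofReal_cos, ← Complex.ofReal_sin]
  have h7 : ((Real.sin (θ / 2) : ℝ) : ℂ) ^ 2 + ((Real.cos (θ / 2) : ℝ) : ℂ) ^ 2 = 1 := by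
    exact_mod_cast Real.sin_sq_add_cos_sq (θ / 2)
  rw [realToUnitary, transpose_smul, smul_mul, smul_mul, Matrix.mul_smul, smul_smul,
    mul_mul_mul_comm, h4, h2, h6]
  rw [blockH, ← h5, h6, blockQ]
  have e : ∀ x y : ℝ, (!![x, y; -y, x] : Matrix (Fin 2) (Fin 2) ℝ).map Complex.ofReal =
      !![(x : ℂ), (y : ℂ); -(y : ℂ), (x : ℂ)] := by
    intro x y
    ext i j
    fin_cases i <;> fin_cases j <;> simp
  have e' : (!![1, Complex.I; 1, -Complex.I] : Matrix (Fin 2) (Fin 2) ℂ)ᵀ =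
      !![1, 1; Complex.I, -Complex.I] := by
    ext i j
    fin_cases i <;> fin_cases j <;> simp
  rw [e, e', mul_fin_two, mul_fin_two]
  generalize ((Real.cos (θ / 2) : ℝ) : ℂ) = c at h7 ⊢
  generalize ((Real.sin (θ / 2) : ℝ) : ℂ) = s at h7 ⊢
  have hI := Complex.I_sq
  ext i j
  fin_cases i <;> fin_cases j <;> simp
  · right; linear_combination c * hI
  · linear_combination (-1 : ℂ) * h7 + ((1 / 2) * c ^ 2 + s ^ 2 + c * s * Complex.I / 2) * hI
  · linear_combination ((c + s * Complex.I) * c / 2) * hI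
  · right; linear_combination c * hI

theorem blockQ_mem (θ : ℝ) : blockQ θ ∈ Matrix.orthogonalGroup (Fin 2) ℝ := by
  rw [mem_orthogonalGroup_iff]
  have h := Real.sin_sq_add_cos_sq (θ / 2)
  ext i j
  fin_cases i <;> fin_cases j <;> simp [blockQ, Matrix.mul_apply, Fin.sum_univ_two] <;> linarith

/-! ### Which blocks contribute a given eigenvalue -/

section Counting

theorem polar_inj {r r' θ θ' : ℝ} (hr : 0 < r) (hr' : 0 < r') (h1 : -Real.pi < θ)
    (h2 : θ ≤ Real.pi) (h1' : -Real.pi < θ') (h2' : θ' ≤ Real.pi) :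
    (r : ℂ) * Complex.exp (θ * Complex.I) = r' * Complex.exp (θ' * Complex.I) ↔
      r = r' ∧ θ = θ' := by
  constructor
  · intro h
    have hn := congrArg norm h
    have ha := congrArg Complex.arg h
    rw [Complex.norm_mul, Complex.norm_mul, Complex.norm_exp_ofReal_mul_I,
      Complex.norm_exp_ofReal_mul_I, Complex.norm_real, Complex.norm_real,
      Real.norm_of_nonneg hr.le, Real.norm_of_nonneg hr'.le, mul_one, mul_one] at hn
    rw [Complex.exp_mul_I, Complex.exp_mul_I,
      Complex.arg_mul_cos_add_sin_mul_I hr ⟨h1, h2⟩,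
      Complex.arg_mul_cos_add_sin_mul_I hr' ⟨h1', h2'⟩] at ha
    exact ⟨hn, ha⟩
  · rintro ⟨rfl, rfl⟩; rfl

open scoped Classical in
/-- The number of diagonal entries of the block that satisfy `p`. -/
noncomputable def CanonicalBlock.eigenCount (b : CanonicalBlock) (p : ℂ → Prop) : ℕ :=
  ∑ q, if p (b.eigen q) then 1 else 0

open scoped Classical in
theorem CanonicalBlock.eigenCount_one (σ : ℝ) (p : ℂ → Prop) :
    (CanonicalBlock.one σ).eigenCount p = if p ((σ : ℂ) ^ 2) then 1 else 0 := by
  change ∑ q : Fin 1, (if p ((σ : ℂ) ^ 2) then 1 else 0) = _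
  simp

open scoped Classical in
theorem CanonicalBlock.eigenCount_two (τ θ : ℝ) (p : ℂ → Prop) :
    (CanonicalBlock.two τ θ).eigenCount p =
      (if p (((τ ^ 2 : ℝ) : ℂ) * Complex.exp (θ * Complex.I)) then 1 else 0) +
      (if p (((τ ^ 2 : ℝ) : ℂ) * Complex.exp ((-θ : ℝ) * Complex.I)) then 1 else 0) := by
  change ∑ q : Fin 2, (if p ((![(τ : ℂ) ^ 2 * Complex.exp (θ * Complex.I),
      (τ : ℂ) ^ 2 * Complex.exp (-(θ * Complex.I))] : Fin 2 → ℂ) q) then 1 else 0) = _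
  rw [Fin.sum_univ_two]
  simp
  congr

theorem sq_eq_iff_eq_sqrt {τ ρ : ℝ} (hτ : 0 < τ) (hρ : 0 < ρ) : τ ^ 2 = ρ ↔ τ = Real.sqrt ρ := by
  constructor
  · rintro rfl; rw [Real.sqrt_sq hτ.le]
  · rintro rfl; exact Real.sq_sqrt hρ.le

theorem two_eigen_eq_iff {τ φ ρ ψ : ℝ} (hb : (CanonicalBlock.two τ φ).Admissible) (hρ : 0 < ρ)
    (h1 : -Real.pi < ψ) (h2 : ψ ≤ Real.pi) :
    ((τ ^ 2 : ℝ) : ℂ) * Complex.exp (φ * Complex.I) = ρ * Complex.exp (ψ * Complex.I) ↔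
      τ = Real.sqrt ρ ∧ φ = ψ := by
  obtain ⟨hτ, h0, hπ⟩ := hb
  rw [polar_inj (by positivity) hρ (by linarith [Real.pi_pos]) hπ h1 h2, sq_eq_iff_eq_sqrt hτ hρ]

/-- Conjugation reduces this to `two_eigen_eq_iff`; it moves the half-open range of angles to
$[-\pi,\pi)$, so $-\rho$ is handled with $\psi=-\pi$. -/
theorem two_eigen_neg_eq_iff {τ φ ρ ψ : ℝ} (hb : (CanonicalBlock.two τ φ).Admissible) (hρ : 0 < ρ)
    (h1 : -Real.pi ≤ ψ) (h2 : ψ < Real.pi) :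
    ((τ ^ 2 : ℝ) : ℂ) * Complex.exp ((-φ : ℝ) * Complex.I) = ρ * Complex.exp (ψ * Complex.I) ↔
      τ = Real.sqrt ρ ∧ φ = -ψ := by
  rw [← two_eigen_eq_iff hb hρ (by linarith) (by linarith), ← (starRingEnd ℂ).injective.eq_iff]
  simp only [map_mul, Complex.conj_ofReal, conj_exp_mul_I]
  simp

theorem one_eigen_ne {σ ρ ψ : ℝ} (hρ : 0 < ρ) (h1 : -Real.pi < ψ) (h2 : ψ ≤ Real.pi)
    (h0 : ψ ≠ 0) : (σ : ℂ) ^ 2 ≠ ρ * Complex.exp (ψ * Complex.I) := by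
  intro h
  have hσ : σ ≠ 0 := by
    rintro rfl
    simp [hρ.ne', Complex.exp_ne_zero] at h
  have e : (σ : ℂ) ^ 2 = ((σ ^ 2 : ℝ) : ℂ) * Complex.exp ((0 : ℝ) * Complex.I) := by simp
  rw [e, polar_inj (by positivity) hρ (by linarith [Real.pi_pos]) Real.pi_pos.le h1 h2] at h
  exact h0 h.2.symm

theorem two_eigen_ne_pos {τ φ x : ℝ} (hb : (CanonicalBlock.two τ φ).Admissible) (hx : 0 < x) :
    ((τ ^ 2 : ℝ) : ℂ) * Complex.exp (φ * Complex.I) ≠ x ∧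
      ((τ ^ 2 : ℝ) : ℂ) * Complex.exp ((-φ : ℝ) * Complex.I) ≠ x := by
  have hpi := Real.pi_pos
  have e : (x : ℂ) = x * Complex.exp ((0 : ℝ) * Complex.I) := by simp
  obtain ⟨-, h0, -⟩ := id hb
  rw [e, Ne, two_eigen_eq_iff hb hx (by linarith) (by linarith), Ne,
    two_eigen_neg_eq_iff hb hx (by linarith) (by linarith)]
  exact ⟨fun h => h0.ne' h.2, fun h => h0.ne' (by simpa using h.2)⟩

variable {b : CanonicalBlock}

-- The factor `1 *` and the orientation `(z = ·)` give this and the next counts the common shape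
-- expected by `eigenvalueMultiplicity_eq`.
open scoped Classical in
theorem eigenCount_upper (hb : b.Admissible) {ρ θ : ℝ} (hρ : 0 < ρ) (h0 : 0 < θ)
    (hπ : θ < Real.pi) : b.eigenCount (ρ * Complex.exp (θ * Complex.I) = ·) =
      1 * if b = .two (Real.sqrt ρ) θ then 1 else 0 := by
  simp only [eq_comm (a := (ρ : ℂ) * _)]
  rcases b with σ | ⟨τ, φ⟩
  · rw [CanonicalBlock.eigenCount_one, if_neg (one_eigen_ne hρ (by linarith) hπ.le h0.ne')]
    simp
  · have hφ0 := hb.2.1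
    simp only [CanonicalBlock.eigenCount_two, two_eigen_eq_iff hb hρ (by linarith) hπ.le,
      two_eigen_neg_eq_iff hb hρ (by linarith) hπ, CanonicalBlock.two.injEq]
    rw [if_neg (c := _ ∧ φ = -θ) (fun h => by linarith [h.2]), add_zero, one_mul]

open scoped Classical in
theorem eigenCount_lower (hb : b.Admissible) {ρ θ : ℝ} (hρ : 0 < ρ) (h0 : 0 < θ)
    (hπ : θ < Real.pi) : b.eigenCount (ρ * Complex.exp (-(θ * Complex.I)) = ·) =
      1 * if b = .two (Real.sqrt ρ) θ then 1 else 0 := by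
  have e : -(θ * Complex.I) = (-θ : ℝ) * Complex.I := by push_cast; ring
  simp only [eq_comm (a := (ρ : ℂ) * _), e]
  rcases b with σ | ⟨τ, φ⟩
  · rw [CanonicalBlock.eigenCount_one,
      if_neg (one_eigen_ne hρ (by linarith) (by linarith) (by linarith))]
    simp
  · have hφ0 := hb.2.1
    simp only [CanonicalBlock.eigenCount_two, two_eigen_eq_iff hb hρ (ψ := -θ) (by linarith)
      (by linarith), two_eigen_neg_eq_iff hb hρ (ψ := -θ) (by linarith) (by linarith),
      CanonicalBlock.two.injEq, neg_neg]
    rw [if_neg (c := _ ∧ φ = -θ) (fun h => by linarith [h.2]), zero_add, one_mul]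

open scoped Classical in
theorem eigenCount_negative (hb : b.Admissible) {ρ : ℝ} (hρ : 0 < ρ) :
    b.eigenCount (-(ρ : ℂ) = ·) = 2 * if b = .two (Real.sqrt ρ) Real.pi then 1 else 0 := by
  have hpi := Real.pi_pos
  have e1 : -(ρ : ℂ) = ρ * Complex.exp (Real.pi * Complex.I) := by
    rw [Complex.exp_pi_mul_I]; ring
  have e2 : -(ρ : ℂ) = ρ * Complex.exp ((-Real.pi : ℝ) * Complex.I) := by
    rw [Complex.ofReal_neg, neg_mul, Complex.exp_neg, Complex.exp_pi_mul_I]; norm_num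
  simp only [eq_comm (a := -(ρ : ℂ))]
  rcases b with σ | ⟨τ, φ⟩
  · rw [CanonicalBlock.eigenCount_one, if_neg]
    · simp
    · rw [e1]; exact one_eigen_ne hρ (by linarith) le_rfl hpi.ne'
  · have h1 : ((τ ^ 2 : ℝ) : ℂ) * Complex.exp (φ * Complex.I) = -(ρ : ℂ) ↔
        τ = Real.sqrt ρ ∧ φ = Real.pi := by
      rw [e1, two_eigen_eq_iff hb hρ (by linarith) le_rfl]
    have h2 : ((τ ^ 2 : ℝ) : ℂ) * Complex.exp ((-φ : ℝ) * Complex.I) = -(ρ : ℂ) ↔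
        τ = Real.sqrt ρ ∧ φ = Real.pi := by
      rw [e2, two_eigen_neg_eq_iff hb hρ le_rfl (by linarith), neg_neg]
    simp only [CanonicalBlock.eigenCount_two, h1, h2, CanonicalBlock.two.injEq, two_mul]

open scoped Classical in
theorem eigenCount_sq (hb : b.Admissible) {σ : ℝ} (hσ : 0 < σ) :
    b.eigenCount ((σ : ℂ) ^ 2 = ·) = 1 * if b = .one σ then 1 else 0 := by
  simp only [eq_comm (a := (σ : ℂ) ^ 2)]
  rcases b with s | ⟨τ, φ⟩
  · have h : (s : ℂ) ^ 2 = (σ : ℂ) ^ 2 ↔ s = σ := by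
      rw [← Complex.ofReal_pow, ← Complex.ofReal_pow, Complex.ofReal_inj]
      exact sq_eq_sq₀ hb hσ.le
    simp only [CanonicalBlock.eigenCount_one, h, CanonicalBlock.one.injEq, one_mul]
  · obtain ⟨h1, h2⟩ := two_eigen_ne_pos hb (pow_pos hσ 2)
    rw [Complex.ofReal_pow σ] at h1 h2
    rw [CanonicalBlock.eigenCount_two, if_neg h1, if_neg h2]
    simp

open scoped Classical in
theorem eigenCount_positive (hb : b.Admissible) :
    b.eigenCount (fun z => ∃ x : ℝ, 0 < x ∧ z = (x : ℂ)) =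
      1 * if ∃ σ : ℝ, 0 < σ ∧ b = .one σ then 1 else 0 := by
  rcases b with s | ⟨τ, φ⟩
  · have h : (∃ x : ℝ, 0 < x ∧ (s : ℂ) ^ 2 = x) ↔
        ∃ σ : ℝ, 0 < σ ∧ CanonicalBlock.one s = .one σ := by
      constructor
      · rintro ⟨x, hx, h⟩
        refine ⟨s, lt_of_le_of_ne hb ?_, rfl⟩
        rintro rfl
        rw [Complex.ofReal_zero, zero_pow two_ne_zero, eq_comm, Complex.ofReal_eq_zero] at h
        exact hx.ne' h
      · rintro ⟨σ, hσ, h⟩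
        obtain rfl : s = σ := by simpa using h
        exact ⟨s ^ 2, by positivity, by simp⟩
    simp only [CanonicalBlock.eigenCount_one, h, one_mul]
  · rw [CanonicalBlock.eigenCount_two, if_neg, if_neg]
    · simp
    · rintro ⟨x, hx, h⟩; exact (two_eigen_ne_pos hb hx).2 h
    · rintro ⟨x, hx, h⟩; exact (two_eigen_ne_pos hb hx).1 h

open scoped Classical in
theorem eigenCount_zero (hb : b.Admissible) :
    b.eigenCount (0 = ·) = 1 * if b = .one 0 then 1 else 0 := by
  rcases b with s | ⟨τ, φ⟩
  · simp [CanonicalBlock.eigenCount_one, eq_comm (a := (0 : ℂ))]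
  · have hτ := hb.1.ne'
    simp [CanonicalBlock.eigenCount_two, hτ, eq_comm (a := (0 : ℂ)), Complex.exp_ne_zero]

open scoped Classical in
theorem sqNorm_count (hb : b.Admissible) :
    (∑ _q : Fin b.size, if b.sqNorm = 0 then 1 else 0) = if b = .one 0 then 1 else 0 := by
  rcases b with s | ⟨τ, φ⟩
  · change (∑ _q : Fin 1, if s ^ 2 = 0 then 1 else 0) = _
    simp
  · have : τ ^ 2 ≠ 0 := pow_ne_zero _ hb.1.ne'
    simp [CanonicalBlock.sqNorm, this]

/-- Every admissible block is detected by the multiplicity of some eigenvalue. -/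
theorem exists_detecting_eigenvalue {c : CanonicalBlock} (hc : c.Admissible) :
    ∃ (z : ℂ) (k : ℕ), 0 < k ∧ ∀ b : CanonicalBlock, b.Admissible →
      b.eigenCount (z = ·) = k * open scoped Classical in if b = c then 1 else 0 := by
  rcases c with σ | ⟨τ, θ⟩
  · rcases eq_or_lt_of_le (show 0 ≤ σ from hc) with rfl | hσ
    · exact ⟨0, 1, one_pos, fun b hb => eigenCount_zero hb⟩
    · exact ⟨_, 1, one_pos, fun b hb => eigenCount_sq hb hσ⟩
  · obtain ⟨hτ, h0, hπ⟩ := hc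
    have hs : Real.sqrt (τ ^ 2) = τ := Real.sqrt_sq hτ.le
    rcases eq_or_lt_of_le hπ with rfl | hπ
    -- At $\theta=\pi$ both eigenvalues of the block coincide with $-\tau^2$, hence the weight 2.
    · exact ⟨_, 2, two_pos, fun b hb => by
        rw [eigenCount_negative hb (pow_pos hτ 2), hs]⟩
    · exact ⟨_, 1, one_pos, fun b hb => by
        rw [eigenCount_upper hb (pow_pos hτ 2) h0 hπ, hs]⟩

end Counting

/-! ### Unitary congruence with arbitrary index types -/

section Congruence

/-- A matrix with orthonormal rows and orthonormal columns. -/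
def IsUnitaryFactor {m n : Type*} [Fintype m] [Fintype n] [DecidableEq m] [DecidableEq n]
    (W : Matrix m n ℂ) : Prop :=
  W * Wᴴ = 1 ∧ Wᴴ * W = 1

theorem entrywiseConj_eq {m n : Type*} (A : Matrix m n ℂ) : entrywiseConj A = Aᴴᵀ := rfl

theorem transpose_mul_entrywiseConj {m n : Type*} [Fintype m] [Fintype n] [DecidableEq m]
    [DecidableEq n] {W : Matrix m n ℂ} (hW : IsUnitaryFactor W) : Wᵀ * entrywiseConj W = 1 := by
  rw [entrywiseConj_eq, ← transpose_mul, hW.2, transpose_one]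

theorem entrywiseConj_mul_transpose {m n : Type*} [Fintype m] [Fintype n] [DecidableEq m]
    [DecidableEq n] {W : Matrix m n ℂ} (hW : IsUnitaryFactor W) : entrywiseConj W * Wᵀ = 1 := by
  rw [entrywiseConj_eq, ← transpose_mul, hW.1, transpose_one]

theorem isUnitaryFactor_of_mem {n : Type*} [Fintype n] [DecidableEq n] {U : Matrix n n ℂ}
    (hU : U ∈ Matrix.unitaryGroup n ℂ) : IsUnitaryFactor U :=
  ⟨mem_unitaryGroup_iff.1 hU, mem_unitaryGroup_iff'.1 hU⟩

/-- Absorbing the reindexing into $W$ removes all casts between sizes; conversely, two-sided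
invertibility of $W$ forces the block sizes to add up to $n$. -/
theorem unitarilyCongruentToSum_iff {n r : ℕ} {k : Fin r → ℕ} {A : Matrix (Fin n) (Fin n) ℂ}
    {M : ∀ i, Matrix (Fin (k i)) (Fin (k i)) ℂ} :
    UnitarilyCongruentToSum A M ↔ ∃ W : Matrix (Fin n) (Σ i, Fin (k i)) ℂ,
      IsUnitaryFactor W ∧ A = W * blockDiagonal' M * Wᵀ := by
  constructor
  · rintro ⟨h, U, hU, rfl⟩
    let ε := finSigmaFinEquiv.trans (finCongr h)
    obtain ⟨h1, h2⟩ := isUnitaryFactor_of_mem hU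
    refine ⟨U.submatrix id ε, ⟨?_, ?_⟩, ?_⟩
    · rw [conjTranspose_submatrix, submatrix_mul_equiv, h1, submatrix_id_id]
    · change (Uᴴ.submatrix ε (Equiv.refl _)) * (U.submatrix (Equiv.refl _) ε) = 1
      rw [submatrix_mul_equiv, h2, submatrix_one_equiv]
    · have hD : blockDiagonal' M = (reindex (finCongr h) (finCongr h)
          (matrixDirectSum M)).submatrix ε ε := by
        ext x y
        simp [ε, matrixDirectSum, reindex_apply]
      rw [hD, transpose_submatrix, submatrix_mul_equiv, submatrix_mul_equiv, submatrix_id_id]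
  · rintro ⟨W, ⟨h1, h2⟩, rfl⟩
    have hcard : Fintype.card (Σ i, Fin (k i)) = n := by
      have := square_of_invertible W Wᴴ h1 h2
      rw [← this, Fintype.card_fin]
    have h : ∑ i, k i = n := by simpa using hcard
    let ε := finSigmaFinEquiv.trans (finCongr h)
    refine ⟨h, W.submatrix id ε.symm, mem_unitaryGroup_iff.2 ?_, ?_⟩
    · change W.submatrix id ε.symm * (W.submatrix id ε.symm)ᴴ = 1
      rw [conjTranspose_submatrix, submatrix_mul_equiv, h1, submatrix_id_id]
    · have hD : reindex (finCongr h) (finCongr h) (matrixDirectSum M) =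
          (blockDiagonal' M).submatrix ε.symm ε.symm := rfl
      rw [hD, transpose_submatrix, submatrix_mul_equiv, submatrix_mul_equiv, submatrix_id_id]

theorem IsUnitaryFactor.mul {l m n : Type*} [Fintype l] [Fintype m] [Fintype n] [DecidableEq l]
    [DecidableEq m] [DecidableEq n] {W : Matrix l m ℂ} {X : Matrix m n ℂ}
    (hW : IsUnitaryFactor W) (hX : IsUnitaryFactor X) : IsUnitaryFactor (W * X) := by
  constructor
  · rw [conjTranspose_mul, Matrix.mul_assoc, ← Matrix.mul_assoc X, hX.1, Matrix.one_mul, hW.1]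
  · rw [conjTranspose_mul, Matrix.mul_assoc, ← Matrix.mul_assoc Wᴴ, hW.2, Matrix.one_mul, hX.2]

theorem IsUnitaryFactor.conjTranspose {m n : Type*} [Fintype m] [Fintype n] [DecidableEq m]
    [DecidableEq n] {W : Matrix m n ℂ} (hW : IsUnitaryFactor W) : IsUnitaryFactor Wᴴ := by
  constructor
  · rw [conjTranspose_conjTranspose, hW.2]
  · rw [conjTranspose_conjTranspose, hW.1]

theorem isUnitaryFactor_blockDiagonal' {r : ℕ} {k : Fin r → ℕ}
    {U : ∀ i, Matrix (Fin (k i)) (Fin (k i)) ℂ} (hU : ∀ i, IsUnitaryFactor (U i)) :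
    IsUnitaryFactor (blockDiagonal' U) := by
  constructor
  · rw [blockDiagonal'_conjTranspose, ← blockDiagonal'_mul, ← blockDiagonal'_one]
    exact congrArg _ (funext fun i => (hU i).1)
  · rw [blockDiagonal'_conjTranspose, ← blockDiagonal'_mul, ← blockDiagonal'_one]
    exact congrArg _ (funext fun i => (hU i).2)

theorem UnitarilyCongruentToSum.congr {n r : ℕ} {k : Fin r → ℕ} {A : Matrix (Fin n) (Fin n) ℂ}
    {M N : ∀ i, Matrix (Fin (k i)) (Fin (k i)) ℂ} (h : UnitarilyCongruentToSum A M)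
    (hMN : ∀ i, ∃ U, IsUnitaryFactor U ∧ M i = U * N i * Uᵀ) : UnitarilyCongruentToSum A N := by
  rw [unitarilyCongruentToSum_iff] at h ⊢
  obtain ⟨W, hW, rfl⟩ := h
  choose U hU hM using hMN
  obtain rfl : M = fun i => U i * N i * (U i)ᵀ := funext hM
  refine ⟨W * blockDiagonal' U, hW.mul (isUnitaryFactor_blockDiagonal' hU), ?_⟩
  rw [blockDiagonal'_mul, blockDiagonal'_mul, ← blockDiagonal'_transpose, transpose_mul]
  simp only [Matrix.mul_assoc]

theorem eq_conjTranspose_congr {m n : Type*} [Fintype m] [Fintype n] [DecidableEq m]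
    [DecidableEq n] {W : Matrix m n ℂ} (hW : IsUnitaryFactor W) {A : Matrix m m ℂ}
    {D : Matrix n n ℂ} (h : A = W * D * Wᵀ) : D = Wᴴ * A * Wᴴᵀ := by
  calc D = (Wᴴ * W) * D * (Wᵀ * entrywiseConj W) := by
        rw [hW.2, transpose_mul_entrywiseConj hW, Matrix.one_mul, Matrix.mul_one]
    _ = _ := by rw [h]; simp only [Matrix.mul_assoc, entrywiseConj_eq]

theorem conjMulSelf_congr {n : ℕ} {ι : Type*} [Fintype ι] [DecidableEq ι]
    {W : Matrix (Fin n) ι ℂ} (hW : IsUnitaryFactor W) (D : Matrix ι ι ℂ) :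
    conjMulSelf (W * D * Wᵀ) = entrywiseConj W * (entrywiseConj D * D) * Wᵀ := by
  have h : entrywiseConj (W * D * Wᵀ) = entrywiseConj W * entrywiseConj D * Wᴴ := by
    simp only [entrywiseConj_eq, conjTranspose_mul, transpose_mul, Matrix.mul_assoc]
    rfl
  rw [conjMulSelf, h]
  calc entrywiseConj W * entrywiseConj D * Wᴴ * (W * D * Wᵀ)
      = entrywiseConj W * entrywiseConj D * (Wᴴ * W) * D * Wᵀ := by
        simp only [Matrix.mul_assoc]
    _ = _ := by rw [hW.2, Matrix.mul_one]; simp only [Matrix.mul_assoc]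

/-- Congruence of $D$ by $W$ is similarity of $\bar DD$ by $\bar W$, since $W^T\bar W=1$. -/
theorem charpoly_conjMulSelf_congr {n : ℕ} {ι : Type*} [Fintype ι] [DecidableEq ι]
    {W : Matrix (Fin n) ι ℂ} (hW : IsUnitaryFactor W) (D : Matrix ι ι ℂ) :
    (conjMulSelf (W * D * Wᵀ)).charpoly = (entrywiseConj D * D).charpoly := by
  have hcard := square_of_invertible W Wᴴ hW.1 hW.2
  rw [conjMulSelf_congr hW, Matrix.mul_assoc, charpoly_mul_comm_of_le _ _ hcard.ge, hcard,
    Nat.sub_self, pow_zero, _root_.one_mul, Matrix.mul_assoc, transpose_mul_entrywiseConj hW,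
    Matrix.mul_one]

theorem isConjugateNormal_congr {n : ℕ} {ι : Type*} [Fintype ι] [DecidableEq ι]
    {W : Matrix (Fin n) ι ℂ} (hW : IsUnitaryFactor W) {D : Matrix ι ι ℂ}
    (hD : Dᴴ * D = entrywiseConj (D * Dᴴ)) : IsConjugateNormal (W * D * Wᵀ) := by
  have h1 : (W * D * Wᵀ)ᴴ * (W * D * Wᵀ) = entrywiseConj W * (Dᴴ * D) * Wᵀ := by
    calc _ = Wᵀᴴ * Dᴴ * (Wᴴ * W) * D * Wᵀ := by
          simp only [conjTranspose_mul, Matrix.mul_assoc]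
      _ = _ := by rw [hW.2, Matrix.mul_one]; simp only [Matrix.mul_assoc]; rfl
  have h2 : (W * D * Wᵀ) * (W * D * Wᵀ)ᴴ = W * (D * Dᴴ) * Wᴴ := by
    calc _ = W * D * (Wᵀ * entrywiseConj W) * Dᴴ * Wᴴ := by
          simp only [conjTranspose_mul, Matrix.mul_assoc]; rfl
      _ = _ := by
          rw [transpose_mul_entrywiseConj hW, Matrix.mul_one]; simp only [Matrix.mul_assoc]
  rw [IsConjugateNormal, h1, h2, hD]
  simp only [entrywiseConj_eq, conjTranspose_mul, transpose_mul, Matrix.mul_assoc,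
    conjTranspose_conjTranspose]

theorem rank_congr {n : ℕ} {ι : Type*} [Fintype ι] [DecidableEq ι]
    {W : Matrix (Fin n) ι ℂ} (hW : IsUnitaryFactor W) (D : Matrix ι ι ℂ) :
    (W * D * Wᵀ).rank = D.rank := by
  apply le_antisymm
  · exact (rank_mul_le_left _ _).trans (rank_mul_le_right _ _)
  · conv_lhs => rw [eq_conjTranspose_congr hW (A := W * D * Wᵀ) rfl]
    exact (rank_mul_le_left _ _).trans (rank_mul_le_right _ _)

end Congruence

/-! ### Existence of the block form -/

section Existence

/-- The antilinear map `x ↦ conj (A x)`. -/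
noncomputable def antilinearMap {n : ℕ} (A : Matrix (Fin n) (Fin n) ℂ) :
    EuclideanSpace ℂ (Fin n) →ₛₗ[starRingEnd ℂ] EuclideanSpace ℂ (Fin n) where
  toFun x := WithLp.toLp 2 (star (A *ᵥ x.ofLp))
  map_add' x y := by
    rw [WithLp.ofLp_add, mulVec_add, star_add, WithLp.toLp_add]
  map_smul' c x := by
    rw [WithLp.ofLp_smul, mulVec_smul, star_smul, WithLp.toLp_smul]
    rfl

theorem inner_antilinearMap {n : ℕ} (A : Matrix (Fin n) (Fin n) ℂ)
    (x y : EuclideanSpace ℂ (Fin n)) :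
    ⟪x, antilinearMap A y⟫_ℂ = ⟪y, antilinearMap Aᵀ x⟫_ℂ := by
  rw [EuclideanSpace.inner_eq_star_dotProduct, EuclideanSpace.inner_eq_star_dotProduct]
  change star (A *ᵥ y.ofLp) ⬝ᵥ star x.ofLp = star (Aᵀ *ᵥ x.ofLp) ⬝ᵥ star y.ofLp
  rw [star_dotProduct_star, star_dotProduct_star, dotProduct_mulVec, mulVec_transpose,
    dotProduct_comm]

theorem antilinearMap_comm {n : ℕ} {A : Matrix (Fin n) (Fin n) ℂ} (hA : IsConjugateNormal A)
    (x : EuclideanSpace ℂ (Fin n)) :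
    antilinearMap Aᵀ (antilinearMap A x) = antilinearMap A (antilinearMap Aᵀ x) := by
  change WithLp.toLp 2 (star (Aᵀ *ᵥ star (A *ᵥ x.ofLp))) =
    WithLp.toLp 2 (star (A *ᵥ star (Aᵀ *ᵥ x.ofLp)))
  congr 1
  have key : ∀ (B : Matrix (Fin n) (Fin n) ℂ) (u : Fin n → ℂ),
      star (B *ᵥ star u) = entrywiseConj B *ᵥ u := by
    intro B u
    rw [star_mulVec, star_star, entrywiseConj_eq, mulVec_transpose]
  rw [key, key, mulVec_mulVec, mulVec_mulVec]
  have h : entrywiseConj Aᵀ * A = entrywiseConj A * Aᵀ := by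
    have h1 : entrywiseConj (A * Aᴴ) = entrywiseConj A * Aᵀ := by
      simp only [entrywiseConj_eq, conjTranspose_mul, transpose_mul, conjTranspose_conjTranspose]
    rw [← h1, ← hA]
    rfl
  rw [h]

theorem exists_hasBlockForm {n : ℕ} {A : Matrix (Fin n) (Fin n) ℂ} (hA : IsConjugateNormal A) :
    ∃ (r : ℕ) (b : Fin r → CanonicalBlock), HasBlockForm A b := by
  obtain ⟨r, b, v, hadm, hb, ho, hs⟩ :=
    exists_block_basis (inner_antilinearMap A) (antilinearMap_comm hA)
  refine ⟨r, b, hadm, unitarilyCongruentToSum_iff.2 ?_⟩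
  have hcard : Fintype.card (Fin n) = Fintype.card (Σ i, Fin (b i).size) := by
    have := Module.finrank_eq_card_basis (Module.Basis.mk ho.linearIndependent hs.ge)
    rw [← this, finrank_euclideanSpace]
  -- The columns are the conjugated basis vectors, so that the action of $S$ on the blocks reads
  -- $A\bar W=WD$.
  let W : Matrix (Fin n) (Σ i, Fin (b i).size) ℂ :=
    Matrix.of fun a x => starRingEnd ℂ (v x.1 x.2 a)
  have h2 : Wᴴ * W = 1 := by
    ext x y
    have h := orthonormal_iff_ite.1 ho y x
    rw [EuclideanSpace.inner_eq_star_dotProduct] at h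
    rw [mul_apply, one_apply]
    simp only [conjTranspose_apply, W, of_apply]
    simp only [dotProduct, Pi.star_apply] at h
    simpa [eq_comm] using h
  have h1 : W * Wᴴ = 1 := (mul_eq_one_comm_of_card_eq _ _ _ hcard).2 h2
  have hW : IsUnitaryFactor W := ⟨h1, h2⟩
  refine ⟨W, hW, ?_⟩
  have hAW : A * entrywiseConj W = W * blockDiagonal' fun i => (b i).toMatrix := by
    ext a ⟨i, q⟩
    have h := congrArg (fun z : EuclideanSpace ℂ (Fin n) => starRingEnd ℂ (z a)) ((hb i).2.1 q)
    have h3 : starRingEnd ℂ (antilinearMap A (v i q) a) = (A * entrywiseConj W) a ⟨i, q⟩ := by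
      change starRingEnd ℂ (star ((A *ᵥ (v i q).ofLp) a)) = _
      rw [starRingEnd_apply, star_star, mul_apply, mulVec, dotProduct]
      simp [entrywiseConj, W]
    rw [← h3]
    refine h.trans ?_
    rw [mul_apply, Fintype.sum_sigma, Finset.sum_eq_single i]
    · simp only [blockDiagonal'_apply_eq, W, of_apply, WithLp.ofLp_sum, Finset.sum_apply, map_sum]
      refine Finset.sum_congr rfl fun p _ => ?_
      simp [mul_comm]
    · intro j _ hj
      refine Finset.sum_eq_zero fun p _ => ?_
      rw [blockDiagonal'_apply_ne _ _ _ hj, mul_zero]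
    · simp
  rw [← hAW, Matrix.mul_assoc, entrywiseConj_mul_transpose hW, Matrix.mul_one]

end Existence

/-! ### Reading the blocks off the spectrum -/

section Multiplicities

variable {n r : ℕ} {A : Matrix (Fin n) (Fin n) ℂ} {b : Fin r → CanonicalBlock}

theorem eigenvalueMultiset_of_hasBlockForm (h : HasBlockForm A b) :
    eigenvalueMultiset (conjMulSelf A) =
      Finset.univ.val.map fun x : Σ i, Fin (b i).size => (b x.1).eigen x.2 := by
  obtain ⟨-, h⟩ := h
  obtain ⟨W, hW, rfl⟩ := unitarilyCongruentToSum_iff.1 h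
  have hD : entrywiseConj (blockDiagonal' fun i => (b i).toMatrix) *
      (blockDiagonal' fun i => (b i).toMatrix) =
      diagonal fun x : Σ i, Fin (b i).size => (b x.1).eigen x.2 := by
    rw [← blockDiagonal'_diagonal fun i q => (b i).eigen q, entrywiseConj_eq,
      blockDiagonal'_conjTranspose, blockDiagonal'_transpose, ← blockDiagonal'_mul]
    exact congrArg _ (funext fun i => (b i).conj_mul_toMatrix)
  rw [eigenvalueMultiset, charpoly_conjMulSelf_congr hW, hD, charpoly_diagonal,
    Polynomial.roots_prod _ _ (by simp [Finset.prod_ne_zero_iff, Polynomial.X_sub_C_ne_zero])]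
  simp

open scoped Classical in
theorem countP_eigenvalueMultiset (h : HasBlockForm A b) {p : ℂ → Prop}
    {Q : CanonicalBlock → Prop} {k : ℕ}
    (hQ : ∀ b : CanonicalBlock, b.Admissible → b.eigenCount p = k * if Q b then 1 else 0) :
    (eigenvalueMultiset (conjMulSelf A)).countP p = k * Nat.card {i // Q (b i)} := by
  rw [eigenvalueMultiset_of_hasBlockForm h, Multiset.countP_map, ← Finset.filter_val,
    Finset.card_val, Finset.card_filter, Fintype.sum_sigma, Nat.card_eq_fintype_card,
    Fintype.card_subtype, Finset.card_filter, Finset.mul_sum]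
  exact Finset.sum_congr rfl fun i _ => hQ _ (h.1 i)

open scoped Classical in
theorem eigenvalueMultiplicity_eq (h : HasBlockForm A b) {z : ℂ}
    {c : CanonicalBlock} {k : ℕ}
    (hQ : ∀ b : CanonicalBlock, b.Admissible →
      b.eigenCount (z = ·) = k * if b = c then 1 else 0) :
    k * Nat.card {i // b i = c} = eigenvalueMultiplicity (conjMulSelf A) z :=
  (countP_eigenvalueMultiset h (Q := (· = c)) hQ).symm

open scoped ComplexOrder in
theorem matrixNullity_eq (h : HasBlockForm A b) :
    Nat.card {i // b i = .one 0} = matrixNullity A := by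
  classical
  obtain ⟨hadm, h⟩ := h
  obtain ⟨W, hW, rfl⟩ := unitarilyCongruentToSum_iff.1 h
  have hD : (blockDiagonal' fun i => (b i).toMatrix)ᴴ * (blockDiagonal' fun i => (b i).toMatrix) =
      diagonal fun x : Σ i, Fin (b i).size => ((b x.1).sqNorm : ℂ) := by
    rw [← blockDiagonal'_diagonal fun i (_ : Fin (b i).size) => ((b i).sqNorm : ℂ),
      blockDiagonal'_conjTranspose, ← blockDiagonal'_mul]
    exact congrArg _ (funext fun i => (b i).conjTranspose_mul_toMatrix)
  have hr : (W * (blockDiagonal' fun i => (b i).toMatrix) * Wᵀ).rank =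
      Fintype.card {x : Σ i, Fin (b i).size // ((b x.1).sqNorm : ℂ) ≠ 0} := by
    -- $D^*D$ is diagonal with the same rank as $D$, and its zero entries come exactly from the
    -- blocks $[0]$.
    rw [rank_congr hW, ← rank_conjTranspose_mul_self, hD, rank_diagonal]
  have hn := LinearMap.finrank_range_add_finrank_ker
    (W * (blockDiagonal' fun i => (b i).toMatrix) * Wᵀ).mulVecLin
  rw [← Matrix.rank, hr, Module.finrank_fintype_fun_eq_card,
    square_of_invertible W Wᴴ hW.1 hW.2] at hn
  have hc := Fintype.card_subtype_compl fun x : Σ i, Fin (b i).size => ((b x.1).sqNorm : ℂ) = 0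
  have hle := Fintype.card_subtype_le fun x : Σ i, Fin (b i).size => ((b x.1).sqNorm : ℂ) = 0
  have hz : Fintype.card {x : Σ i, Fin (b i).size // ((b x.1).sqNorm : ℂ) = 0} =
      Nat.card {i // b i = .one 0} := by
    rw [Fintype.card_subtype, Finset.card_filter, Fintype.sum_sigma, Nat.card_eq_fintype_card,
      Fintype.card_subtype, Finset.card_filter]
    refine Finset.sum_congr rfl fun i _ => ?_
    simp only [Complex.ofReal_eq_zero]
    exact sqNorm_count (hadm i)
  simp only [Ne, matrixNullity] at *
  omega

theorem exists_equiv_of_eigenvalueMultiset_eq {n' r' : ℕ} {A' : Matrix (Fin n') (Fin n') ℂ}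
    {b' : Fin r' → CanonicalBlock} (h : HasBlockForm A b) (h' : HasBlockForm A' b')
    (he : eigenvalueMultiset (conjMulSelf A) = eigenvalueMultiset (conjMulSelf A')) :
    ∃ e : Fin r ≃ Fin r', ∀ i, b' (e i) = b i := by
  have hcard : ∀ c, Nat.card {i // b i = c} = Nat.card {i // b' i = c} := by
    intro c
    by_cases hc : c.Admissible
    · obtain ⟨z, k, hk, hz⟩ := exists_detecting_eigenvalue hc
      have h1 := eigenvalueMultiplicity_eq h hz
      have h2 := eigenvalueMultiplicity_eq h' hz
      rw [eigenvalueMultiplicity] at h1 h2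
      rw [he, ← h2] at h1
      exact Nat.eq_of_mul_eq_mul_left hk h1
    · have e1 : IsEmpty {i // b i = c} := ⟨fun i => hc (i.2 ▸ h.1 i.1)⟩
      have e2 : IsEmpty {i // b' i = c} := ⟨fun i => hc (i.2 ▸ h'.1 i.1)⟩
      simp
  -- Fibres of `b` and `b'` over each block are equinumerous; gluing fibrewise bijections gives the
  -- permutation.
  have f := fun c => Finite.card_eq.1 (hcard c)
  refine ⟨(Equiv.sigmaFiberEquiv b).symm.trans
    ((Equiv.sigmaCongrRight fun c => (f c).some).trans (Equiv.sigmaFiberEquiv b')), fun i => ?_⟩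
  exact ((f (b i)).some ⟨i, rfl⟩).2

end Multiplicities

/-! ### Congruence criterion, converse and real blocks -/

section Classification

theorem eigenvalueMultiset_congr {n : ℕ} {A B : Matrix (Fin n) (Fin n) ℂ}
    (h : UnitarilyCongruent A B) :
    eigenvalueMultiset (conjMulSelf A) = eigenvalueMultiset (conjMulSelf B) := by
  obtain ⟨U, hU, rfl⟩ := h
  rw [eigenvalueMultiset, charpoly_conjMulSelf_congr (isUnitaryFactor_of_mem hU)]
  rfl

/-- Permuting the columns of $W$ to match the blocks gives $A=YDY^T$ and $B=XDX^T$ with the same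
$D$, so $YX^*$ carries $B$ to $A$. -/
theorem unitarilyCongruent_of_equiv {n r r' : ℕ} {A B : Matrix (Fin n) (Fin n) ℂ}
    {b : Fin r → CanonicalBlock} {b' : Fin r' → CanonicalBlock} (hA : HasBlockForm A b)
    (hB : HasBlockForm B b') (e : Fin r ≃ Fin r') (he : ∀ i, b' (e i) = b i) :
    UnitarilyCongruent A B := by
  obtain rfl : b = fun i => b' (e i) := funext fun i => (he i).symm
  obtain ⟨W, hW, rfl⟩ := unitarilyCongruentToSum_iff.1 hA.2
  obtain ⟨X, hX, rfl⟩ := unitarilyCongruentToSum_iff.1 hB.2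
  let ε : (Σ i, Fin (b' (e i)).size) ≃ Σ j, Fin (b' j).size :=
    Equiv.sigmaCongrLeft (β := fun j => Fin (b' j).size) e
  have hD : (blockDiagonal' fun i => (b' (e i)).toMatrix) =
      (blockDiagonal' fun j => (b' j).toMatrix).submatrix ε ε := by
    ext ⟨i, p⟩ ⟨j, q⟩
    change _ = blockDiagonal' (fun j => (b' j).toMatrix) ⟨e i, p⟩ ⟨e j, q⟩
    rcases eq_or_ne i j with rfl | hij
    · rw [blockDiagonal'_apply_eq, blockDiagonal'_apply_eq]
    · rw [blockDiagonal'_apply_ne _ _ _ hij,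
        blockDiagonal'_apply_ne _ _ _ fun h => hij (e.injective h)]
  let Y := W.submatrix id ε.symm
  have hY : IsUnitaryFactor Y := by
    constructor
    · change W.submatrix id ε.symm * (W.submatrix id ε.symm)ᴴ = 1
      rw [conjTranspose_submatrix, submatrix_mul_equiv, hW.1, submatrix_id_id]
    · change (Wᴴ.submatrix ε.symm (Equiv.refl _)) * (W.submatrix (Equiv.refl _) ε.symm) = 1
      rw [submatrix_mul_equiv, hW.2, submatrix_one_equiv]
  have hWY : W = Y.submatrix id ε := by
    ext i j
    simp [Y]
  have hA' : W * (blockDiagonal' fun i => (b' (e i)).toMatrix) * Wᵀ =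
      Y * (blockDiagonal' fun j => (b' j).toMatrix) * Yᵀ := by
    rw [hD, hWY, transpose_submatrix, submatrix_mul_equiv, submatrix_mul_equiv, submatrix_id_id]
  have hZ := hY.mul hX.conjTranspose
  refine ⟨Y * Xᴴ, mem_unitaryGroup_iff.2 hZ.1, ?_⟩
  have hD' := eq_conjTranspose_congr hX
    (A := X * (blockDiagonal' fun j => (b' j).toMatrix) * Xᵀ) rfl
  rw [hA']
  conv_lhs => rw [hD']
  rw [transpose_mul]
  simp only [Matrix.mul_assoc]

theorem unitarilyCongruent_iff {n : ℕ} {A B : Matrix (Fin n) (Fin n) ℂ}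
    (hA : IsConjugateNormal A) (hB : IsConjugateNormal B) :
    UnitarilyCongruent A B ↔
      eigenvalueMultiset (conjMulSelf A) = eigenvalueMultiset (conjMulSelf B) := by
  refine ⟨eigenvalueMultiset_congr, fun h => ?_⟩
  obtain ⟨r, b, hb⟩ := exists_hasBlockForm hA
  obtain ⟨r', b', hb'⟩ := exists_hasBlockForm hB
  obtain ⟨e, he⟩ := exists_equiv_of_eigenvalueMultiset_eq hb hb' h
  exact unitarilyCongruent_of_equiv hb hb' e he

theorem HasBlockForm.isConjugateNormal {n r : ℕ} {A : Matrix (Fin n) (Fin n) ℂ}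
    {b : Fin r → CanonicalBlock} (h : HasBlockForm A b) : IsConjugateNormal A := by
  obtain ⟨W, hW, rfl⟩ := unitarilyCongruentToSum_iff.1 h.2
  refine isConjugateNormal_congr hW ?_
  rw [blockDiagonal'_conjTranspose, ← blockDiagonal'_mul, ← blockDiagonal'_mul]
  simp only [CanonicalBlock.conjTranspose_mul_toMatrix, CanonicalBlock.mul_conjTranspose_toMatrix,
    blockDiagonal'_diagonal, entrywiseConj_eq, diagonal_conjTranspose, diagonal_transpose]
  congr 1
  ext x
  simp

theorem CanonicalBlock.exists_toMatrix_eq (b : CanonicalBlock) :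
    ∃ U, IsUnitaryFactor U ∧ b.toMatrix = U * b.toRealMatrix * Uᵀ := by
  rcases b with σ | ⟨τ, θ⟩
  · refine ⟨1, ⟨by simp, by simp⟩, ?_⟩
    rw [Matrix.one_mul, transpose_one, Matrix.mul_one]
    rfl
  · have h := realToUnitary_mem θ
    refine ⟨(realToUnitary θ : Matrix (Fin 2) (Fin 2) ℂ), ⟨h, mul_eq_one_comm.1 h⟩, ?_⟩
    change (τ : ℂ) • blockH θ = realToUnitary θ * ((τ : ℂ) • (blockQ θ).map Complex.ofReal) *
      (realToUnitary θ)ᵀ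
    rw [Matrix.mul_smul, smul_mul, ← blockH_eq]

theorem unitarilyCongruentToSum_real_iff {n r : ℕ} (A : Matrix (Fin n) (Fin n) ℂ)
    (b : Fin r → CanonicalBlock) (S : Finset (Fin r)) :
    UnitarilyCongruentToSum A (fun i => (b i).toMatrix) ↔
      UnitarilyCongruentToSum A
        (fun i => if i ∈ S then (b i).toRealMatrix else (b i).toMatrix) := by
  have key : ∀ i, ∃ U, IsUnitaryFactor U ∧
      (b i).toMatrix = U * (if i ∈ S then (b i).toRealMatrix else (b i).toMatrix) * Uᵀ := by
    intro i
    split_ifs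
    · exact (b i).exists_toMatrix_eq
    · exact ⟨1, ⟨by simp, by simp⟩, by simp⟩
  refine ⟨fun h => h.congr key, fun h => h.congr fun i => ?_⟩
  obtain ⟨U, hU, h⟩ := key i
  exact ⟨Uᴴ, hU.conjTranspose, eq_conjTranspose_congr hU h⟩

end Classification

theorem mainTheorem5 (n : ℕ) :
    -- Existence of the block form.
    (∀ A : Matrix (Fin n) (Fin n) ℂ, IsConjugateNormal A →
      ∃ (r : ℕ) (b : Fin r → CanonicalBlock), HasBlockForm A b) ∧
    -- The eigenvalues determine the blocks up to permutation.
    (∀ A A' : Matrix (Fin n) (Fin n) ℂ, IsConjugateNormal A → IsConjugateNormal A' →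
      eigenvalueMultiset (conjMulSelf A) = eigenvalueMultiset (conjMulSelf A') →
      ∀ (r r' : ℕ) (b : Fin r → CanonicalBlock) (b' : Fin r' → CanonicalBlock),
        HasBlockForm A b → HasBlockForm A' b' →
        ∃ e : Fin r ≃ Fin r', ∀ i, b' (e i) = b i) ∧
    -- How the eigenvalues determine the blocks.
    (∀ A : Matrix (Fin n) (Fin n) ℂ, IsConjugateNormal A →
      ∀ (r : ℕ) (b : Fin r → CanonicalBlock), HasBlockForm A b →
        (∀ ρ θ : ℝ, 0 < ρ → 0 < θ → θ < Real.pi →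
          Nat.card {i // b i = .two (Real.sqrt ρ) θ} =
            eigenvalueMultiplicity (conjMulSelf A) (ρ * Complex.exp (θ * Complex.I)) ∧
          Nat.card {i // b i = .two (Real.sqrt ρ) θ} =
            eigenvalueMultiplicity (conjMulSelf A) (ρ * Complex.exp (-(θ * Complex.I)))) ∧
        (∀ ρ : ℝ, 0 < ρ →
          2 * Nat.card {i // b i = .two (Real.sqrt ρ) Real.pi} =
            eigenvalueMultiplicity (conjMulSelf A) (-(ρ : ℂ))) ∧
        (∀ σ : ℝ, 0 < σ →
          Nat.card {i // b i = .one σ} =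
            eigenvalueMultiplicity (conjMulSelf A) ((σ : ℂ) ^ 2)) ∧
        Nat.card {i // ∃ σ : ℝ, 0 < σ ∧ b i = .one σ} =
          numPositiveEigenvalues (conjMulSelf A) ∧
        Nat.card {i // b i = .one 0} = matrixNullity A) ∧
    -- The criterion for unitary congruence.
    (∀ A B : Matrix (Fin n) (Fin n) ℂ, IsConjugateNormal A → IsConjugateNormal B →
      (UnitarilyCongruent A B ↔
        eigenvalueMultiset (conjMulSelf A) = eigenvalueMultiset (conjMulSelf B))) ∧
    -- Any of the unitary two-by-two blocks may be replaced by real orthogonal ones.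
    (∀ θ : ℝ, blockQ θ ∈ Matrix.orthogonalGroup (Fin 2) ℝ) ∧
    (∀ (A : Matrix (Fin n) (Fin n) ℂ) (r : ℕ) (b : Fin r → CanonicalBlock) (S : Finset (Fin r)),
      (∀ i, (b i).Admissible) →
      (UnitarilyCongruentToSum A (fun i => (b i).toMatrix) ↔
        UnitarilyCongruentToSum A
          (fun i => if i ∈ S then (b i).toRealMatrix else (b i).toMatrix))) ∧
    -- The converse.
    (∀ (A : Matrix (Fin n) (Fin n) ℂ) (r : ℕ) (b : Fin r → CanonicalBlock),
      HasBlockForm A b → IsConjugateNormal A) := by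
  refine ⟨fun A hA => exists_hasBlockForm hA,
    fun A A' _ _ he r r' b b' hb hb' => exists_equiv_of_eigenvalueMultiset_eq hb hb' he,
    fun A _ r b hb => ⟨fun ρ θ hρ h0 hπ => ⟨?_, ?_⟩, fun ρ hρ => ?_, fun σ hσ => ?_, ?_,
      matrixNullity_eq hb⟩,
    fun A B hA hB => unitarilyCongruent_iff hA hB, blockQ_mem,
    fun A r b S _ => unitarilyCongruentToSum_real_iff A b S,
    fun A r b hb => hb.isConjugateNormal⟩
  · rw [← eigenvalueMultiplicity_eq hb fun b hb => eigenCount_upper hb hρ h0 hπ, one_mul]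
  · rw [← eigenvalueMultiplicity_eq hb fun b hb => eigenCount_lower hb hρ h0 hπ, one_mul]
  · exact eigenvalueMultiplicity_eq hb fun b hb => eigenCount_negative hb hρ
  · rw [← eigenvalueMultiplicity_eq hb fun b hb => eigenCount_sq hb hσ, one_mul]
  · have h := countP_eigenvalueMultiset hb (Q := fun b => ∃ σ : ℝ, 0 < σ ∧ b = .one σ)
      fun b hb => eigenCount_positive hb
    rw [one_mul] at h
    exact h.symm
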